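/- For all real numbers $0<\varepsilon,\delta<1$ there exist $\gamma>0$ and $d_0$ (depending only on $\varepsilon$ and $\delta$) such that the following holds for every real $d\ge d_0$. Let $G$ be a finite simple graph and let $v_1,v_2,\ldots,v_n$ be an ordering of its vertices. For each $j$ write $N^+(v_j)=N(v_j)\cap\{v_1,\ldots,v_{j-1}\}$ for the forward neighborhood of $v_j$, and write $e(S)$ for the number of edges of $G$ with both endpoints in $S$. Suppose that 1. $|N^+(v_j)|\le d$ for all $1\le j\le n$ (that is, $G$ is $d$-degenerate with degeneracy order $v_1,\ldots,v_n$), and $|N^+(v_j)|\le(1-\varepsilon)d$ for all $1\le j\le n-\delta d/4$; 2. $e(N^+(v_j))\le(1-\delta)\binom d2$ for all $1\le j\le n$, where $\binom d2=d(d-1)/2$. Then $\chi(G)\le(1-\gamma)d$. -/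

import Mathlib

namespace DegenColoring

/-- The forward neighborhood of the vertex at position `i` of an ordering `v` of the vertices of
`G`: the neighbors of `v i` that come before `v i` in the ordering. -/
def forwardNbhd {V : Type*} (G : SimpleGraph V) {n : ℕ} (v : Fin n ≃ V) (i : Fin n) : Set V :=
  {u | G.Adj (v i) u ∧ v.symm u < i}

/-- `v` is a degeneracy order witnessing that `G` is `d`-degenerate: every vertex has at most `d`
neighbors that come before it. -/
def IsDegeneracyOrder {V : Type*} (G : SimpleGraph V) (d : ℝ) {n : ℕ} (v : Fin n ≃ V) : Prop :=
  ∀ i : Fin n, ((forwardNbhd G v i).ncard : ℝ) ≤ d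

/-- The number `e(S)` of edges of the subgraph of `G` induced on the vertex set `S`. -/
noncomputable def edgesIn {V : Type*} (G : SimpleGraph V) (S : Set V) : ℕ :=
  (G.induce S).edgeSet.ncard

end DegenColoring

/-!
All vertices but the last `δ d / 4` or so have at most `(1 - ε) d` preceding neighbors, so greedy
coloring handles these early vertices with about `(1 - ε) d` colors. This leaves about `ε d` colors
free, and they are used to create repetitions: the early vertices are partially colored so that
every late vertex sees `γ d + 1` repeated colors among its preceding neighbors. Then the late
vertices, too, can be colored greedily with `(1 - γ) d` colors.

The repetitions come from `⌊η d⌋` color classes, chosen one after another. Sparsity of the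
preceding neighborhood of a late vertex means that the neighborhood contains `Ω(δ d²)` non-edges;
as there are only about `δ d / 4` late vertices and few vertices are covered by the new classes,
this remains true inside its early, still uncolored part, unless enough repetitions have been
created already (`mul_sq_le_nonEdges`). A random independent set, obtained from a random set of
density `1 / d` by deleting each vertex with a preceding neighbor in the set, contains both ends of
one of these non-edges with probability bounded below by a constant `β`. Averaging gives one
independent set that creates a repetition for a `β`-fraction of the late vertices, in any given
weighting (`exists_indep_meeting_twice`).

Since there are only `O(d)` late vertices, multiplicative weights finish the argument
(`exists_partial_coloring_cost_le`): each late vertex has weight `2 ^ (-r)`, where `r` is the number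
of repetitions it sees so far. After `⌊η d⌋` classes the total weight is at most
`d (1 - β / 2) ^ ⌊η d⌋`, which for large `d` is less than `2 ^ (-s)` with `s` slightly above `γ d`,
so that no late vertex is left with fewer than `s` repetitions. The greedy completion is
`colorable_of_cost_lt`.
-/

namespace DegenColoring

section

open Finset
open scoped Classical

/-! ### Preceding neighbors, non-edges and the cost of a partial coloring -/

/-- The finite set of neighbors of `x` that precede `x` in the linear order on the vertices. -/
noncomputable def precedingNbrs {α : Type*} [Fintype α] [LinearOrder α] (G : SimpleGraph α)
    (x : α) : Finset α :=
  univ.filter fun y => y < x ∧ G.Adj x y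

/-- The non-edges of `G` inside `S`, each listed once, as an increasing pair. -/
noncomputable def nonEdges {α : Type*} [LinearOrder α] (G : SimpleGraph α)
    (S : Finset α) : Finset (α × α) :=
  (S ×ˢ S).filter fun p => p.1 < p.2 ∧ ¬ G.Adj p.1 p.2

/-- A partial coloring is a map to `ℕ` in which the value `0` means "not yet colored". Its cost
on `S` is the number of colors that `S` needs if all its uncolored vertices get new, distinct
colors. -/
noncomputable def cost {α : Type*} (c : α → ℕ) (S : Finset α) : ℕ :=
  ((S.filter (c · ≠ 0)).image c).card + (S.filter (c · = 0)).card

theorem cost_le_cost_add_card_sdiff {α : Type*} [LinearOrder α] (c : α → ℕ) {S T : Finset α} :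
    cost c T ≤ cost c S + (T \ S).card := by
  have h1 : (T.filter (c · ≠ 0)).image c ⊆
      (S.filter (c · ≠ 0)).image c ∪ ((T \ S).filter (c · ≠ 0)).image c := by
    rw [← image_union, ← filter_union]
    exact image_subset_image (filter_subset_filter _ (by simp))
  have h2 : T.filter (c · = 0) ⊆ S.filter (c · = 0) ∪ (T \ S).filter (c · = 0) := by
    rw [← filter_union]
    exact filter_subset_filter _ (by simp)
  have h3 := (card_le_card h1).trans (card_union_le _ _)
  have h4 := (card_le_card h2).trans (card_union_le _ _)
  have h5 : (((T \ S).filter (c · ≠ 0)).image c).card ≤ ((T \ S).filter (c · ≠ 0)).card :=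
    card_image_le
  have h6 := card_filter_add_card_filter_not (s := T \ S) (c · = 0)
  simp only [ne_eq] at *
  unfold cost
  simp only [ne_eq]
  omega

/-! ### An independent set that meets many sparse sets twice -/

theorem exp_neg_six_le_pow {q : ℕ} (hq : 2 ≤ q) {m : ℕ} (hm : m ≤ 3 * q) :
    Real.exp (-6) ≤ (1 - 1 / (q : ℝ)) ^ m := by
  have hq' : (2 : ℝ) ≤ q := by exact_mod_cast hq
  have h1 : Real.exp (-(2 / (q : ℝ))) ≤ 1 - 1 / (q : ℝ) := by
    rw [Real.exp_neg, inv_le_comm₀ (Real.exp_pos _) (by rw [sub_pos, div_lt_one] <;> linarith)]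
    refine le_trans ?_ (Real.add_one_le_exp _)
    rw [inv_le_iff_one_le_mul₀ (by rw [sub_pos, div_lt_one] <;> linarith)]
    have : (0 : ℝ) < q := by linarith
    field_simp
    nlinarith
  calc Real.exp (-6) ≤ Real.exp (m * (-(2 / (q : ℝ)))) := by
        apply Real.exp_le_exp.2
        have hm' : (m : ℝ) ≤ 3 * q := by exact_mod_cast hm
        have : (0 : ℝ) < q := by linarith
        have : (m : ℝ) * (2 / q) ≤ 6 := by
          rw [mul_div_assoc', div_le_iff₀ this]; linarith
        linarith
    _ = Real.exp (-(2 / (q : ℝ))) ^ m := by rw [Real.exp_nat_mul]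
    _ ≤ _ := pow_le_pow_left₀ (Real.exp_pos _).le h1 m

/-- A uniformly random map to `Fin q` vanishes at the two points `u` and `w` and nowhere on `T` with
probability `(1 / q) ^ 2 * (1 - 1 / q) ^ |T|`; the statement counts such maps. -/
theorem card_vanishing_pair {α : Type*} [Fintype α] {q : ℕ} [NeZero q] {u w : α}
    (huw : u ≠ w) {T : Finset α} (hu : u ∉ T) (hw : w ∉ T) :
    ((univ.filter fun f : α → Fin q => f u = 0 ∧ f w = 0 ∧ ∀ x ∈ T, f x ≠ 0).card : ℝ)
      = (q : ℝ) ^ Fintype.card α * ((1 / (q : ℝ)) ^ 2 * (1 - 1 / (q : ℝ)) ^ T.card) := by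
  have hq : (q : ℝ) ≠ 0 := by exact_mod_cast NeZero.ne q
  have hset : (univ.filter fun f : α → Fin q => f u = 0 ∧ f w = 0 ∧ ∀ x ∈ T, f x ≠ 0) =
      Fintype.piFinset fun x : α =>
        if x ∈ ({u, w} : Finset α) then ({0} : Finset (Fin q)) else if x ∈ T then {0}ᶜ else univ := by
    ext f
    simp only [mem_filter, mem_univ, true_and, Fintype.mem_piFinset]
    constructor
    · rintro ⟨h1, h2, h3⟩ x
      split_ifs with h h'
      · rcases mem_insert.1 h with rfl | h
        · simpa using h1
        · rw [mem_singleton.1 h]; simpa using h2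
      · simpa using h3 x h'
      · simp
    · intro h
      refine ⟨by simpa using h u, by simpa using h w, fun x hx => ?_⟩
      have hxu : x ≠ u := fun h => hu (h ▸ hx)
      have hxw : x ≠ w := fun h => hw (h ▸ hx)
      simpa [hxu, hxw, hx] using h x
  rw [hset, Fintype.card_piFinset]
  have hfac : ∀ x : α, (((if x ∈ ({u, w} : Finset α) then ({0} : Finset (Fin q))
      else if x ∈ T then {0}ᶜ else univ).card : ℕ) : ℝ) =
      q * ((if x ∈ ({u, w} : Finset α) then 1 / (q : ℝ) else 1) *
        (if x ∈ T then 1 - 1 / (q : ℝ) else 1)) := by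
    intro x
    by_cases h : x ∈ ({u, w} : Finset α)
    · have hx : x ∉ T := by
        rcases mem_insert.1 h with rfl | h
        · exact hu
        · rw [mem_singleton.1 h]; exact hw
      simp [h, hx, hq]
    · by_cases hx : x ∈ T
      · have h1 : 1 ≤ q := Nat.one_le_iff_ne_zero.2 (NeZero.ne q)
        rw [if_neg h, if_pos hx, if_neg h, if_pos hx, card_compl, card_singleton,
          Fintype.card_fin, Nat.cast_sub h1]
        field_simp
        simp
      · simp [h, hx]
  rw [Nat.cast_prod, prod_congr rfl fun x _ => hfac x, prod_mul_distrib, prod_mul_distrib]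
  simp only [prod_ite_mem, univ_inter, prod_const, card_univ]
  rw [card_pair huw]

/-- A random map `f` to `Fin q` yields the independent set of the vertices of `U` at which `f`
vanishes, but at none of their preceding neighbors. It contains two vertices of a set `S` as soon
as the zeros of `f` on `S` are the ends of a non-edge, and `f` has no zeros among the preceding
neighbors of these; for distinct non-edges these events are disjoint, so that their probabilities
add up. Averaging over `f` then gives one independent set that serves many of the sets `S j`. -/
theorem exists_indep_meeting_twice {α ι : Type*} [Fintype α] [LinearOrder α] (G : SimpleGraph α)
    {q : ℕ} (hq : 2 ≤ q) {U : Finset α} (hU : ∀ x ∈ U, (precedingNbrs G x).card ≤ q)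
    {J : Finset ι} {S : ι → Finset α} {ρ : ℝ} (hS : ∀ j ∈ J, S j ⊆ U)
    (hSq : ∀ j ∈ J, (S j).card ≤ q) (hρ : ∀ j ∈ J, ρ * (q : ℝ) ^ 2 ≤ (nonEdges G (S j)).card)
    {w : ι → ℝ} (hw : ∀ j, 0 ≤ w j) :
    ∃ K ⊆ U, (∀ x ∈ K, ∀ y ∈ K, ¬ G.Adj x y) ∧
      ρ * Real.exp (-6) * ∑ j ∈ J, w j ≤ ∑ j ∈ J, if 2 ≤ (S j ∩ K).card then w j else 0 := by
  have : NeZero q := ⟨by omega⟩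
  have hq0 : (0 : ℝ) < q := by exact_mod_cast (by omega : 0 < q)
  let K : (α → Fin q) → Finset α := fun f =>
    U.filter fun x => f x = 0 ∧ ∀ y ∈ precedingNbrs G x, f y ≠ 0
  have hcount : ∀ j ∈ J, ρ * Real.exp (-6) * (q : ℝ) ^ Fintype.card α ≤
      ((univ.filter fun f : α → Fin q => 2 ≤ (S j ∩ K f).card).card : ℝ) := by
    intro j hj
    -- If `f` vanishes at the ends of `p` and nowhere on `T p`, then both ends lie in `K f`.
    let T : α × α → Finset α := fun p =>
      (S j \ {p.1, p.2}) ∪ (precedingNbrs G p.1 ∪ precedingNbrs G p.2)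
    let E : α × α → Finset (α → Fin q) := fun p =>
      univ.filter fun f => f p.1 = 0 ∧ f p.2 = 0 ∧ ∀ x ∈ T p, f x ≠ 0
    have hT : ∀ p ∈ nonEdges G (S j), p.1 ∉ T p ∧ p.2 ∉ T p ∧ (T p).card ≤ 3 * q := by
      intro p hp
      simp only [nonEdges, mem_filter, mem_product] at hp
      obtain ⟨⟨h1, h2⟩, hlt, hadj⟩ := hp
      -- The ends of `p` are not preceding neighbors of one another since `p` is a non-edge.
      have hadj' : ¬ G.Adj p.2 p.1 := fun h => hadj h.symm
      refine ⟨by simp [T, precedingNbrs, hadj'], by simp [T, precedingNbrs, hadj], ?_⟩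
      have a1 := hU _ (hS j hj h1)
      have a2 := hU _ (hS j hj h2)
      have a3 := hSq j hj
      have a4 : (S j \ {p.1, p.2}).card ≤ (S j).card := card_le_card sdiff_subset
      have a5 := card_union_le (S j \ {p.1, p.2}) (precedingNbrs G p.1 ∪ precedingNbrs G p.2)
      have a6 := card_union_le (precedingNbrs G p.1) (precedingNbrs G p.2)
      show (_ ∪ _ : Finset α).card ≤ _
      omega
    -- A map in `E p` has no zeros on `S j` except the ends of `p`, so that it determines `p`.
    have hdisj : (nonEdges G (S j) : Set (α × α)).PairwiseDisjoint E := by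
      have key : ∀ p ∈ nonEdges G (S j), ∀ f ∈ E p, ∀ x ∈ S j, (f x = 0 ↔ x = p.1 ∨ x = p.2) := by
        intro p hp f hf x hx
        simp only [E, mem_filter, mem_univ, true_and] at hf
        constructor
        · intro h0
          by_contra hne
          exact hf.2.2 x (by simp only [T, mem_union, mem_sdiff]; left; exact ⟨hx, by simpa using hne⟩) h0
        · rintro (rfl | rfl)
          exacts [hf.1, hf.2.1]
      intro p hp p' hp' hne
      refine disjoint_left.2 fun f hf hf' => hne ?_
      have k1 := key p hp f hf
      have k2 := key p' hp' f hf'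
      have hp := hp
      have hp' := hp'
      simp only [nonEdges, coe_filter, mem_product, Set.mem_ofPred_eq] at hp hp'
      obtain ⟨⟨h1, h2⟩, hlt, -⟩ := hp
      obtain ⟨⟨h1', h2'⟩, hlt', -⟩ := hp'
      have e1 := (k2 _ h1).1 ((k1 _ h1).2 (Or.inl rfl))
      have e2 := (k2 _ h2).1 ((k1 _ h2).2 (Or.inr rfl))
      rcases e1 with e1 | e1 <;> rcases e2 with e2 | e2
      · rw [e1, e2] at hlt; exact absurd hlt (lt_irrefl _)
      · exact Prod.ext e1 e2
      · rw [e1, e2] at hlt; exact absurd hlt hlt'.not_gt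
      · rw [e1, e2] at hlt; exact absurd hlt (lt_irrefl _)
    have hsub : (nonEdges G (S j)).biUnion E ⊆
        univ.filter fun f : α → Fin q => 2 ≤ (S j ∩ K f).card := by
      intro f hf
      obtain ⟨p, hp, hf⟩ := mem_biUnion.1 hf
      simp only [E, mem_filter, mem_univ, true_and] at hf
      simp only [nonEdges, mem_filter, mem_product] at hp
      obtain ⟨⟨h1, h2⟩, hlt, -⟩ := hp
      simp only [mem_filter, mem_univ, true_and]
      rw [← card_pair hlt.ne]
      refine card_le_card fun x hx => ?_
      rcases mem_insert.1 hx with rfl | hx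
      · refine mem_inter.2 ⟨h1, mem_filter.2 ⟨hS j hj h1, hf.1, fun y hy => hf.2.2 y ?_⟩⟩
        simp [T, hy]
      · rw [mem_singleton.1 hx]
        refine mem_inter.2 ⟨h2, mem_filter.2 ⟨hS j hj h2, hf.2.1, fun y hy => hf.2.2 y ?_⟩⟩
        simp [T, hy]
    have hEcard : ∀ p ∈ nonEdges G (S j),
        (q : ℝ) ^ Fintype.card α * ((1 / (q : ℝ)) ^ 2 * Real.exp (-6)) ≤ ((E p).card : ℝ) := by
      intro p hp
      obtain ⟨t1, t2, t3⟩ := hT p hp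
      have hlt : p.1 < p.2 := (mem_filter.1 hp).2.1
      have hE : ((E p).card : ℝ) = (q : ℝ) ^ Fintype.card α *
          ((1 / (q : ℝ)) ^ 2 * (1 - 1 / (q : ℝ)) ^ (T p).card) := by
        convert card_vanishing_pair (q := q) hlt.ne t1 t2
      rw [hE]
      have := exp_neg_six_le_pow hq t3
      gcongr
    calc ρ * Real.exp (-6) * (q : ℝ) ^ Fintype.card α
        = (ρ * (q : ℝ) ^ 2) * ((q : ℝ) ^ Fintype.card α * ((1 / (q : ℝ)) ^ 2 * Real.exp (-6))) := by
          field_simp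
      _ ≤ (nonEdges G (S j)).card *
          ((q : ℝ) ^ Fintype.card α * ((1 / (q : ℝ)) ^ 2 * Real.exp (-6))) := by
          gcongr
          exact hρ j hj
      _ ≤ ∑ p ∈ nonEdges G (S j), ((E p).card : ℝ) := by
          rw [← nsmul_eq_mul]; exact card_nsmul_le_sum _ _ _ hEcard
      _ = (((nonEdges G (S j)).biUnion E).card : ℝ) := by
          rw [card_biUnion hdisj]; push_cast; rfl
      _ ≤ _ := by exact_mod_cast card_le_card hsub
  obtain ⟨f, -, hf⟩ : ∃ f ∈ (univ : Finset (α → Fin q)), ρ * Real.exp (-6) * ∑ j ∈ J, w j ≤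
      ∑ j ∈ J, if 2 ≤ (S j ∩ K f).card then w j else 0 := by
    refine exists_le_of_sum_le univ_nonempty ?_
    rw [sum_comm, sum_const, card_univ, Fintype.card_fun, Fintype.card_fin, nsmul_eq_mul, mul_sum,
      mul_sum]
    refine sum_le_sum fun j hj => ?_
    rw [← sum_filter, sum_const, nsmul_eq_mul]
    push_cast
    calc _ = ρ * Real.exp (-6) * (q : ℝ) ^ Fintype.card α * w j := by ring
      _ ≤ _ := mul_le_mul_of_nonneg_right (hcount j hj) (hw j)
  refine ⟨K f, filter_subset _ _, fun x hx y hy hxy => ?_, hf⟩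
  obtain ⟨-, hx0, hx1⟩ := mem_filter.1 hx
  obtain ⟨-, hy0, hy1⟩ := mem_filter.1 hy
  rcases lt_or_gt_of_ne hxy.ne with h | h
  · exact hy1 x (by simp [precedingNbrs, h, hxy.symm]) hx0
  · exact hx1 y (by simp [precedingNbrs, h, hxy]) hy0

/-! ### Multiplicative weights -/

/-- Giving one new color to a set of uncolored vertices does not increase the cost of `S`, and
decreases it if the set contains two vertices of `S`. -/
theorem cost_recolor_add_le {α : Type*} [LinearOrder α] {c : α → ℕ} {a : ℕ} {K : Finset α}
    (hK : ∀ x ∈ K, c x = 0) (S : Finset α) :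
    cost (fun x => if x ∈ K then a + 1 else c x) S + (if 2 ≤ (S ∩ K).card then 1 else 0)
      ≤ cost c S := by
  set c' : α → ℕ := fun x => if x ∈ K then a + 1 else c x with hc'
  have h0 : (S.filter (c' · = 0)).card + (S ∩ K).card = (S.filter (c · = 0)).card := by
    rw [← card_union_of_disjoint]
    · congr 1
      ext x
      by_cases hx : x ∈ K <;> simp [hc', hx, hK]
    · refine disjoint_left.2 fun x hx hx' => ?_
      have := (mem_filter.1 hx).2
      simp [hc', (mem_inter.1 hx').2] at this
  have h1 : (S.filter (c' · ≠ 0)).image c' ⊆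
      (S.filter (c · ≠ 0)).image c ∪ (S ∩ K).image fun _ => a + 1 := by
    intro y hy
    obtain ⟨x, hx, rfl⟩ := mem_image.1 hy
    obtain ⟨hxS, hx⟩ := mem_filter.1 hx
    by_cases hxK : x ∈ K
    · refine mem_union_right _ (mem_image.2 ⟨x, mem_inter.2 ⟨hxS, hxK⟩, by simp [hc', hxK]⟩)
    · have e : c' x = c x := by simp [hc', hxK]
      rw [e] at hx ⊢
      exact mem_union_left _ (mem_image_of_mem _ (mem_filter.2 ⟨hxS, hx⟩))
  have h2 := (card_le_card h1).trans (card_union_le _ _)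
  have h3 : ((S ∩ K).image fun _ => a + 1).card ≤ 1 :=
    card_le_one.2 (by simp +contextual)
  have h4 : ((S ∩ K).image fun _ => a + 1).card ≤ (S ∩ K).card := card_image_le
  unfold cost
  split_ifs <;> omega

theorem cost_le_card_uncolored_add {α : Type*} [LinearOrder α] {c : α → ℕ} {a : ℕ}
    (hc : ∀ x, c x ≤ a) (S : Finset α) : cost c S ≤ (S.filter (c · = 0)).card + a := by
  have : ((S.filter (c · ≠ 0)).image c) ⊆ Icc 1 a := by
    intro y hy
    obtain ⟨x, hx, rfl⟩ := mem_image.1 hy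
    exact mem_Icc.2 ⟨Nat.one_le_iff_ne_zero.2 (mem_filter.1 hx).2, hc x⟩
  have := card_le_card this
  rw [Nat.card_Icc] at this
  unfold cost
  omega

/-- Multiplicative weights: as long as the cost of `S j` has not dropped by `s`, the set `S j` has
weight `2 ^ (cost - |S j|)`. Every new color class can be chosen so as to at least halve the weight of a
`β`-fraction of the sets, so that the total weight decays geometrically. A set whose cost has not
dropped by `s` has more than `|S j| - s - a` uncolored vertices, so that `hρ` supplies the
non-edges needed for the next color class. -/
theorem exists_partial_coloring_weight_le {α ι : Type*} [Fintype α] [LinearOrder α]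
    (G : SimpleGraph α) {q : ℕ} (hq : 2 ≤ q) {F : Finset α}
    (hF : ∀ x ∈ F, (precedingNbrs G x).card ≤ q) {J : Finset ι} {S : ι → Finset α} {β : ℝ}
    (hS : ∀ j ∈ J, S j ⊆ F) (hSq : ∀ j ∈ J, (S j).card ≤ q) {s t : ℕ} (hβ1 : β ≤ 1)
    (hρ : ∀ j ∈ J, ∀ T ⊆ S j, (S j).card ≤ T.card + s + t →
      β * Real.exp 6 * (q : ℝ) ^ 2 ≤ (nonEdges G T).card) :
    ∀ a ≤ t, ∃ c : α → ℕ, (∀ x, c x ≤ a) ∧ (∀ x, c x ≠ 0 → x ∈ F) ∧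
      (∀ x y, G.Adj x y → c x ≠ 0 → c x ≠ c y) ∧
      ∑ j ∈ J.filter (fun j => (S j).card < cost c (S j) + s),
        (2 : ℝ) ^ cost c (S j) / 2 ^ (S j).card ≤ J.card * (1 - β / 2) ^ a := by
  intro a
  induction a with
  | zero =>
    intro _
    refine ⟨fun _ => 0, by simp, by simp, by simp, ?_⟩
    rw [pow_zero, mul_one]
    calc _ ≤ ∑ j ∈ J.filter (fun j => (S j).card < cost (fun _ => 0) (S j) + s), (1 : ℝ) := by
          refine sum_le_sum fun j _ => ?_
          simp [cost]
      _ ≤ J.card := by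
          simp only [sum_const, nsmul_eq_mul, mul_one]
          exact_mod_cast card_filter_le _ _
  | succ a ih =>
    intro ha
    obtain ⟨c, hca, hcF, hcG, hc⟩ := ih (by omega)
    set A := J.filter (fun j => (S j).card < cost c (S j) + s) with hA
    set w : ι → ℝ := fun j => (2 : ℝ) ^ cost c (S j) / 2 ^ (S j).card with hw
    have hw0 : ∀ j, 0 ≤ w j := fun j => by positivity
    obtain ⟨K, hKU, hKind, hK⟩ := exists_indep_meeting_twice G hq (U := F.filter (c · = 0))
      (fun x hx => hF x (mem_filter.1 hx).1) (J := A)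
      (S := fun j => (S j).filter (c · = 0)) (ρ := β * Real.exp 6)
      (fun j hj => filter_subset_filter _ (hS j (mem_filter.1 hj).1))
      (fun j hj => (card_filter_le _ _).trans (hSq j (mem_filter.1 hj).1))
      (fun j hj => by
        obtain ⟨hj, hlt⟩ := mem_filter.1 hj
        refine hρ j hj _ (filter_subset _ _) ?_
        have := cost_le_card_uncolored_add hca (S j)
        omega) hw0
    have hK0 : ∀ x ∈ K, c x = 0 := fun x hx => (mem_filter.1 (hKU hx)).2
    have hSK : ∀ j, (S j).filter (c · = 0) ∩ K = S j ∩ K := by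
      intro j
      ext x
      simp only [mem_inter, mem_filter]
      exact ⟨fun h => ⟨h.1.1, h.2⟩, fun h => ⟨⟨h.1, hK0 x h.2⟩, h.2⟩⟩
    simp only [hSK] at hK
    rw [mul_assoc β, ← Real.exp_add, add_neg_cancel, Real.exp_zero, mul_one] at hK
    have hcost := fun j => cost_recolor_add_le (a := a) hK0 (S j)
    set c' : α → ℕ := fun x => if x ∈ K then a + 1 else c x with hc'
    refine ⟨c', fun x => ?_, fun x hx => ?_, fun x y hxy hx => ?_, ?_⟩
    · by_cases hx : x ∈ K
      · simp [hc', hx]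
      · simpa [hc', hx] using (hca x).trans (Nat.le_succ a)
    · by_cases hxK : x ∈ K
      · exact (mem_filter.1 (hKU hxK)).1
      · exact hcF x (by simpa [hc', hxK] using hx)
    · by_cases hxK : x ∈ K <;> by_cases hyK : y ∈ K
      · exact absurd hxy (hKind x hxK y hyK)
      · have := hca y
        simp only [hc', hxK, hyK, if_true, if_false]
        omega
      · have := hca x
        simp only [hc', hxK, hyK, if_true, if_false]
        omega
      · simp only [hc', hxK, hyK, if_false] at hx ⊢
        exact hcG x y hxy hx
    · have hsub : J.filter (fun j => (S j).card < cost c' (S j) + s) ⊆ A := by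
        intro j hj
        obtain ⟨hj, hlt⟩ := mem_filter.1 hj
        refine mem_filter.2 ⟨hj, ?_⟩
        have := hcost j
        omega
      have hterm : ∀ j, (2 : ℝ) ^ cost c' (S j) / 2 ^ (S j).card ≤
          w j - (if 2 ≤ (S j ∩ K).card then w j else 0) / 2 := by
        intro j
        have h := hcost j
        split_ifs at h ⊢
        · have : (2 : ℝ) ^ (cost c' (S j) + 1) ≤ 2 ^ cost c (S j) :=
            pow_le_pow_right₀ (by norm_num) h
          rw [pow_succ] at this
          have : (2 : ℝ) ^ cost c' (S j) ≤ 2 ^ cost c (S j) / 2 := by linarith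
          calc _ ≤ (2 : ℝ) ^ cost c (S j) / 2 / 2 ^ (S j).card := by gcongr
            _ = w j - w j / 2 := by simp only [hw]; ring
        · rw [zero_div, sub_zero]
          simp only [hw]
          gcongr
          · norm_num
          · omega
      calc _ ≤ ∑ j ∈ A, (2 : ℝ) ^ cost c' (S j) / 2 ^ (S j).card :=
            sum_le_sum_of_subset_of_nonneg hsub fun _ _ _ => by positivity
        _ ≤ ∑ j ∈ A, (w j - (if 2 ≤ (S j ∩ K).card then w j else 0) / 2) :=
            sum_le_sum fun j _ => hterm j
        _ = ∑ j ∈ A, w j - (∑ j ∈ A, if 2 ≤ (S j ∩ K).card then w j else 0) / 2 := by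
            rw [sum_sub_distrib, sum_div]
        _ ≤ (∑ j ∈ A, w j) * (1 - β / 2) := by linarith
        _ ≤ J.card * (1 - β / 2) ^ a * (1 - β / 2) := by
            apply mul_le_mul_of_nonneg_right hc; linarith
        _ = _ := by ring

/-- Once the total weight is below `2 ^ (-s)`, no set can have a cost within `s` of its size. -/
theorem exists_partial_coloring_cost_le {α ι : Type*} [Fintype α] [LinearOrder α]
    (G : SimpleGraph α) {q : ℕ} (hq : 2 ≤ q) {F : Finset α}
    (hF : ∀ x ∈ F, (precedingNbrs G x).card ≤ q) {J : Finset ι} {S : ι → Finset α} {β : ℝ}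
    (hS : ∀ j ∈ J, S j ⊆ F) (hSq : ∀ j ∈ J, (S j).card ≤ q) {s t : ℕ} (hβ1 : β ≤ 1)
    (hρ : ∀ j ∈ J, ∀ T ⊆ S j, (S j).card ≤ T.card + s + t →
      β * Real.exp 6 * (q : ℝ) ^ 2 ≤ (nonEdges G T).card)
    (hJ : J.card * (1 - β / 2) ^ t * 2 ^ s < 1) :
    ∃ c : α → ℕ, (∀ x, c x ≤ t) ∧ (∀ x, c x ≠ 0 → x ∈ F) ∧
      (∀ x y, G.Adj x y → c x ≠ 0 → c x ≠ c y) ∧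
      ∀ j ∈ J, cost c (S j) + s ≤ (S j).card := by
  obtain ⟨c, h1, h2, h3, h4⟩ :=
    exists_partial_coloring_weight_le G hq hF hS hSq hβ1 hρ t le_rfl
  refine ⟨c, h1, h2, h3, fun j hj => ?_⟩
  by_contra! hlt
  have h5 : (2 : ℝ) ^ cost c (S j) / 2 ^ (S j).card ≤ J.card * (1 - β / 2) ^ t :=
    (single_le_sum (f := fun j => (2 : ℝ) ^ cost c (S j) / 2 ^ (S j).card)
      (fun _ _ => by positivity) (mem_filter.2 ⟨hj, hlt⟩)).trans h4
  have h6 : (1 : ℝ) ≤ (2 : ℝ) ^ cost c (S j) / 2 ^ (S j).card * 2 ^ s := by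
    rw [div_mul_eq_mul_div, ← pow_add, le_div_iff₀ (by positivity), one_mul]
    exact pow_le_pow_right₀ (by norm_num) hlt.le
  have : (0 : ℝ) < 2 ^ s := by positivity
  nlinarith

/-! ### Greedy completion of a partial coloring -/

/-- Greedy coloring of the vertices of `Q` along a linear order, extending a given map: every
vertex `x` takes a color of its palette `P x` that its preceding neighbors do not use. -/
theorem exists_greedy_extension {α : Type*} [Fintype α] [LinearOrder α] (G : SimpleGraph α)
    (Q : Finset α) (P : α → Finset ℕ) (c₀ : α → ℕ)
    (h : ∀ c : α → ℕ, (∀ x, x ∉ Q → c x = c₀ x) → ∀ x ∈ Q,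
      ((precedingNbrs G x).image c).card < (P x).card) :
    ∃ c : α → ℕ, (∀ x, x ∉ Q → c x = c₀ x) ∧
      ∀ x ∈ Q, c x ∈ P x ∧ ∀ y, y < x → G.Adj x y → c x ≠ c y := by
  -- Induction over the initial segments `R` of the order.
  suffices H : ∀ R : Finset α, (∀ x ∈ R, ∀ y < x, y ∈ R) → ∃ c : α → ℕ,
      (∀ x, x ∉ Q → c x = c₀ x) ∧
      ∀ x ∈ Q, x ∈ R → c x ∈ P x ∧ ∀ y, y < x → G.Adj x y → c x ≠ c y by
    obtain ⟨c, h1, h2⟩ := H univ (by simp)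
    exact ⟨c, h1, fun x hx => h2 x hx (mem_univ x)⟩
  intro R
  induction R using Finset.induction_on_max with
  | empty => exact fun _ => ⟨c₀, fun _ _ => rfl, by simp⟩
  | insert x R hmax ih =>
    intro hR
    have hxR : x ∉ R := fun hx => lt_irrefl _ (hmax x hx)
    obtain ⟨c, h1, h2⟩ := ih fun y hy z hz =>
      (mem_insert.1 (hR y (mem_insert_of_mem hy) z hz)).resolve_left
        (hz.trans (hmax y hy)).ne
    by_cases hxQ : x ∈ Q
    -- The count in `h` leaves a color of the palette that is free at the new last vertex `x`.
    · obtain ⟨a, haP, ha⟩ := exists_mem_notMem_of_card_lt_card (h c h1 x hxQ)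
      refine ⟨Function.update c x a, fun y hy => ?_, fun y hyQ hyR => ?_⟩
      · rw [Function.update_of_ne (fun e : y = x => hy (e ▸ hxQ))]
        exact h1 y hy
      · rcases mem_insert.1 hyR with rfl | hyR
        · rw [Function.update_self]
          refine ⟨haP, fun z hz hadj e => ha ?_⟩
          rw [Function.update_of_ne hz.ne] at e
          exact mem_image.2 ⟨z, by simp [precedingNbrs, hz, hadj], e.symm⟩
        · have hyx := hmax y hyR
          rw [Function.update_of_ne hyx.ne]
          refine ⟨(h2 y hyQ hyR).1, fun z hz hadj => ?_⟩
          rw [Function.update_of_ne (hz.trans hyx).ne]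
          exact (h2 y hyQ hyR).2 z hz hadj
    · refine ⟨c, h1, fun y hyQ hyR => h2 y hyQ ?_⟩
      exact (mem_insert.1 hyR).resolve_left fun e => hxQ (e ▸ hyQ)

/-- A partial coloring of an initial segment `F` with the colors `1, …, t` extends to a coloring
with `k` colors if the rest of `F` can be colored greedily with the colors `t + 1, …, k`, and the
vertices outside `F` have enough repeated colors among their preceding neighbors. -/
theorem colorable_of_cost_lt {α : Type*} [Fintype α] [LinearOrder α] (G : SimpleGraph α)
    {F : Finset α} (hFlower : ∀ x ∈ F, ∀ y < x, y ∈ F) {t k : ℕ} {c₀ : α → ℕ}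
    (hct : ∀ x, c₀ x ≤ t) (hcF : ∀ x, c₀ x ≠ 0 → x ∈ F)
    (hcG : ∀ x y, G.Adj x y → c₀ x ≠ 0 → c₀ x ≠ c₀ y)
    (hF : ∀ x ∈ F, (precedingNbrs G x).card + t < k)
    (hL : ∀ x, x ∉ F → cost c₀ (precedingNbrs G x) < k) (htk : t ≤ k) : G.Colorable k := by
  obtain ⟨c, hc₀, hc⟩ := exists_greedy_extension G (univ.filter (c₀ · = 0))
    (fun x => if x ∈ F then Icc (t + 1) k else Icc 1 k) c₀ (by
      intro c hc x hx
      by_cases hxF : x ∈ F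
      · have := hF x hxF
        have h1 : ((precedingNbrs G x).image c).card ≤ (precedingNbrs G x).card := card_image_le
        simp only [hxF, if_true, Nat.card_Icc]
        omega
      · have h1 := hL x hxF
        simp only [hxF, if_false, Nat.card_Icc]
        have h2 : (precedingNbrs G x).image c ⊆
            ((precedingNbrs G x).filter (c₀ · ≠ 0)).image c₀ ∪
              ((precedingNbrs G x).filter (c₀ · = 0)).image c := by
          intro a ha
          obtain ⟨y, hy, rfl⟩ := mem_image.1 ha
          by_cases h0 : c₀ y = 0
          · exact mem_union_right _ (mem_image_of_mem _ (mem_filter.2 ⟨hy, h0⟩))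
          · refine mem_union_left _ (mem_image.2 ⟨y, mem_filter.2 ⟨hy, h0⟩, ?_⟩)
            exact (hc y (by simp [h0])).symm
        have h3 := (card_le_card h2).trans (card_union_le _ _)
        have h4 : (((precedingNbrs G x).filter (c₀ · = 0)).image c).card ≤
          ((precedingNbrs G x).filter (c₀ · = 0)).card := card_image_le
        unfold cost at h1
        omega)
  have hmem : ∀ x, c x ∈ Icc 1 k := by
    intro x
    by_cases h0 : c₀ x = 0
    · have := (hc x (by simp [h0])).1
      split_ifs at this
      · rw [mem_Icc] at this ⊢
        omega
      · exact this
    · rw [hc₀ x (by simp [h0]), mem_Icc]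
      have := hct x
      omega
  have hlt : ∀ x y, y < x → G.Adj x y → c x ≠ c y := by
    intro x y hyx hadj
    by_cases h0 : c₀ x = 0
    · exact (hc x (by simp [h0])).2 y hyx hadj
    · rw [hc₀ x (by simp [h0])]
      by_cases hy0 : c₀ y = 0
      -- Here `y` lies in `F` as well, so that its color comes from the fresh range above `t`.
      · have := (hc y (by simp [hy0])).1
        rw [if_pos (hFlower x (hcF x h0) y hyx), mem_Icc] at this
        have := hct x
        omega
      · rw [hc₀ y (by simp [hy0])]
        exact hcG x y hadj h0
  let C : G.Coloring (Icc 1 k) := SimpleGraph.Coloring.mk (fun x => ⟨c x, hmem x⟩) (by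
    intro x y hxy e
    have e' : c x = c y := congrArg Subtype.val e
    rcases lt_or_gt_of_ne hxy.ne with h | h
    · exact hlt y x h hxy.symm e'.symm
    · exact hlt x y h hxy e')
  simpa using C.colorable

/-! ### Counting non-edges -/

theorem two_mul_card_filter_fst_lt_snd {α : Type*} [LinearOrder α] (S : Finset α) :
    2 * ((S ×ˢ S).filter fun p => p.1 < p.2).card + S.card = S.card * S.card := by
  have hswap : ((S ×ˢ S).filter fun p => p.2 < p.1).card =
      ((S ×ˢ S).filter fun p => p.1 < p.2).card := by
    refine card_bij (fun p _ => (p.2, p.1)) ?_ ?_ ?_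
    · intro p hp
      simpa [and_comm] using hp
    · rintro ⟨a, b⟩ _ ⟨a', b'⟩ _ h
      simp only [Prod.mk.injEq] at h ⊢
      exact h.symm
    · rintro ⟨a, b⟩ hp
      exact ⟨(b, a), by simpa [and_comm] using hp, rfl⟩
  have hoff : S.offDiag = ((S ×ˢ S).filter fun p => p.1 < p.2) ∪
      (S ×ˢ S).filter fun p => p.2 < p.1 := by
    ext ⟨a, b⟩
    simp only [mem_offDiag, mem_union, mem_filter, mem_product, ne_eq, ← lt_or_lt_iff_ne]
    tauto
  have hcard : S.offDiag.card = S.card * S.card - S.card := offDiag_card S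
  rw [hoff, card_union_of_disjoint (disjoint_left.2 fun p hp hp' =>
    lt_asymm (mem_filter.1 hp).2 (mem_filter.1 hp').2), hswap] at hcard
  have := Nat.le_mul_self S.card
  omega

/-- Pairs inside `T` are non-edges or edges, and the edges lie in the induced subgraph on any
larger set. The graph on the ordered type `α` is the pullback of `G` along `v`. -/
theorem card_mul_self_le_nonEdges {V α : Type*} [Fintype α] [LinearOrder α] (G : SimpleGraph V)
    (v : α ≃ V) (T : Finset α) {X : Set V} (hT : ∀ x ∈ T, v x ∈ X) :
    T.card * T.card ≤ 2 * (nonEdges (G.comap v) T).card + 2 * edgesIn G X + T.card := by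
  have : Finite V := Finite.of_equiv α v
  set E := (T ×ˢ T).filter fun p => p.1 < p.2 ∧ (G.comap v).Adj p.1 p.2 with hE
  have hsplit : ((T ×ˢ T).filter fun p => p.1 < p.2).card =
      (nonEdges (G.comap v) T).card + E.card := by
    rw [nonEdges, hE, ← filter_filter, ← filter_filter, add_comm,
      card_filter_add_card_filter_not]
  have hle : E.card ≤ edgesIn G X := by
    rw [edgesIn, ← Set.ncard_image_of_injective _ (Sym2.map.injective Subtype.val_injective),
      ← Set.ncard_coe_finset]
    refine Set.ncard_le_ncard_of_injOn (fun p => s(v p.1, v p.2)) ?_ ?_ (Set.toFinite _)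
    · intro p hp
      simp only [hE, coe_filter, mem_product, Set.mem_ofPred_eq] at hp
      exact ⟨s(⟨v p.1, hT _ hp.1.1⟩, ⟨v p.2, hT _ hp.1.2⟩), by simpa using hp.2.2, by simp⟩
    · rintro ⟨a, b⟩ hp ⟨a', b'⟩ hp' h
      simp only [hE, coe_filter, mem_product, Set.mem_ofPred_eq] at hp hp'
      simp only [Sym2.eq_iff, EmbeddingLike.apply_eq_iff_eq] at h
      rcases h with ⟨rfl, rfl⟩ | ⟨rfl, rfl⟩
      · rfl
      · exact absurd hp.2.1 hp'.2.1.not_gt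
  have := two_mul_card_filter_fst_lt_snd T
  omega

/-- A set of nearly `d` vertices that spans at most `(1 - δ) d (d - 1) / 2` edges has a quadratic
number of non-edges. -/
theorem mul_sq_le_nonEdges {V α : Type*} [Fintype α] [LinearOrder α] (G : SimpleGraph V)
    (v : α ≃ V) {T : Finset α} {X : Set V} (hT : ∀ x ∈ T, v x ∈ X) {δ d : ℝ} (hδ0 : 0 < δ)
    (hδ1 : δ < 1) (hd : 64 ≤ δ * d) (hTd : (T.card : ℝ) ≤ d)
    (hTlow : (1 - 7 * δ / 16) * d ≤ T.card)
    (hX : (edgesIn G X : ℝ) ≤ (1 - δ) * (d * (d - 1) / 2)) :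
    δ / 32 * d ^ 2 ≤ (nonEdges (G.comap v) T).card := by
  have hd0 : 0 < d := by nlinarith
  have h1 : (T.card : ℝ) * T.card ≤
      2 * (nonEdges (G.comap v) T).card + 2 * edgesIn G X + T.card := by
    exact_mod_cast card_mul_self_le_nonEdges G v T hT
  have h2 : ((1 - 7 * δ / 16) * d) * ((1 - 7 * δ / 16) * d) ≤ (T.card : ℝ) * T.card := by
    have : 0 ≤ (1 - 7 * δ / 16) * d := mul_nonneg (by linarith) hd0.le
    gcongr
  have h3 : 64 * d ≤ δ * d * d := by gcongr
  have h4 : (1 - 7 * δ / 8) * d ^ 2 ≤ (1 - 7 * δ / 16) * d * ((1 - 7 * δ / 16) * d) := by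
    linear_combination (norm := ring_nf) (49 / 256) * mul_nonneg (sq_nonneg δ) (sq_nonneg d)
    exact le_rfl
  have h5 : δ * d ≤ d := by nlinarith
  linarith

/-! ### Choice of the constants -/

/-- The numerical conditions under which `k = ⌊(1 - γ) d⌋` colors suffice when the random part of
the coloring uses `⌊η d⌋` colors, each serving a fraction `β` of the sets. -/
structure Parameters (ε δ β η γ d : ℝ) : Prop where
  β_pos : 0 < β
  β_le_one : β ≤ 1
  β_eq : β * Real.exp 6 = δ / 32
  η_pos : 0 < η
  η_le_ε : η ≤ ε / 16
  η_le_δ : η ≤ δ / 16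
  γ_eq : γ = β * η / 4
  le_ε_mul : 16 ≤ ε * d
  le_δ_mul : 64 ≤ δ * d
  log_lt : Real.log d + 3 < γ * d

theorem exists_parameters {ε δ : ℝ} (hε0 : 0 < ε) (hδ0 : 0 < δ) (hδ1 : δ < 1) :
    ∃ β η γ : ℝ, 0 < γ ∧ ∃ d₀ : ℝ, ∀ d, d₀ ≤ d → Parameters ε δ β η γ d := by
  have hβ : 0 < δ / 32 * Real.exp (-6) := by positivity
  have hη : 0 < min ε δ / 16 := by positivity
  refine ⟨δ / 32 * Real.exp (-6), min ε δ / 16,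
    δ / 32 * Real.exp (-6) * (min ε δ / 16) / 4, by positivity, ?_⟩
  set γ := δ / 32 * Real.exp (-6) * (min ε δ / 16) / 4 with hγ
  have hγ0 : 0 < γ := by positivity
  have hlog := (Real.isLittleO_log_id_atTop.bound (half_pos hγ0))
  obtain ⟨d₁, hd₁⟩ := Filter.eventually_atTop.1 hlog
  refine ⟨max (max d₁ (16 / ε)) (max (64 / δ) (8 / γ)), fun d hd => ?_⟩
  simp only [max_le_iff, div_le_iff₀ hε0, div_le_iff₀ hδ0, div_le_iff₀ hγ0] at hd
  obtain ⟨⟨h1, h2⟩, h3, h4⟩ := hd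
  have hd0 : 0 < d := by
    by_contra! h
    nlinarith
  refine ⟨hβ, ?_, ?_, hη, ?_, ?_, rfl, by linarith, by linarith, ?_⟩
  · have : Real.exp (-6) ≤ 1 := Real.exp_le_one_iff.2 (by norm_num)
    nlinarith
  · rw [mul_assoc, ← Real.exp_add]; simp
  · have := min_le_left ε δ; linarith
  · have := min_le_right ε δ; linarith
  · have := hd₁ d h1
    simp only [id, Real.norm_eq_abs, abs_of_pos hd0] at this
    have := (le_abs_self _).trans this
    linarith

theorem Parameters.mul_pow_mul_two_pow_lt_one {ε δ β η γ d : ℝ} (h : Parameters ε δ β η γ d)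
    (hd : 0 < d) {m s t : ℕ} (hm : (m : ℝ) ≤ d) (hs : (s : ℝ) ≤ γ * d + 2)
    (ht : η * d < t + 1) : m * (1 - β / 2) ^ t * 2 ^ s < 1 := by
  have hβ := h.β_pos
  have hβ1 := h.β_le_one
  have hlog := h.log_lt
  have hγ := h.γ_eq
  have h1 : (1 - β / 2) ^ t ≤ Real.exp (t * (-(β / 2))) := by
    rw [Real.exp_nat_mul]
    exact pow_le_pow_left₀ (by linarith) (Real.one_sub_le_exp_neg _) t
  have h2 : (2 : ℝ) ^ s ≤ Real.exp s := by
    rw [← mul_one (s : ℝ), Real.exp_nat_mul]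
    refine pow_le_pow_left₀ (by norm_num) ?_ s
    linarith [Real.add_one_le_exp (1 : ℝ)]
  calc m * (1 - β / 2) ^ t * 2 ^ s
      ≤ Real.exp (Real.log d) * Real.exp (t * (-(β / 2))) * Real.exp s := by
        rw [Real.exp_log hd]
        have : 0 ≤ 1 - β / 2 := by linarith
        gcongr
    _ = Real.exp (Real.log d + t * (-(β / 2)) + s) := by rw [Real.exp_add, Real.exp_add]
    _ < 1 := by
        rw [Real.exp_lt_one_iff]
        nlinarith

/-! ### Early and late vertices -/

theorem card_filter_lt_add_one_le {n : ℕ} {b : ℝ} (hb : 0 ≤ b) :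
    ((univ.filter fun i : Fin n => ¬ ((i : ℕ) : ℝ) + 1 ≤ (n : ℝ) - b).card : ℝ) ≤ b + 1 := by
  refine le_trans ?_ (Nat.ceil_lt_add_one hb).le
  have hlt : ∀ i ∈ (univ.filter fun i : Fin n => ¬ ((i : ℕ) : ℝ) + 1 ≤ (n : ℝ) - b),
      n < (i : ℕ) + 1 + ⌈b⌉₊ := by
    intro i hi
    have h1 := (mem_filter.1 hi).2
    have h2 := Nat.le_ceil b
    have : (n : ℝ) < (i : ℕ) + 1 + ⌈b⌉₊ := by linarith
    exact_mod_cast this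
  rw [Nat.cast_le, ← card_range ⌈b⌉₊]
  refine card_le_card_of_injOn (fun i => n - 1 - (i : ℕ)) ?_ ?_
  · intro i hi
    have := hlt i hi
    simp only [coe_range, Set.mem_Iio]
    omega
  · intro i _ j _ hij
    simp only at hij
    ext
    omega

theorem image_precedingNbrs_comap {V : Type*} (G : SimpleGraph V) {n : ℕ} (v : Fin n ≃ V)
    (i : Fin n) : v '' (precedingNbrs (G.comap v) i : Set (Fin n)) = forwardNbhd G v i := by
  ext u
  simp only [precedingNbrs, coe_filter, mem_univ, true_and, forwardNbhd, SimpleGraph.comap_adj]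
  constructor
  · rintro ⟨j, ⟨h1, h2⟩, rfl⟩
    exact ⟨h2, by simpa using h1⟩
  · rintro ⟨h1, h2⟩
    exact ⟨v.symm u, ⟨h2, by simpa using h1⟩, by simp⟩

theorem ncard_forwardNbhd {V : Type*} (G : SimpleGraph V) {n : ℕ} (v : Fin n ≃ V)
    (i : Fin n) : (forwardNbhd G v i).ncard = (precedingNbrs (G.comap v) i).card := by
  rw [← image_precedingNbrs_comap, Set.ncard_image_of_injective _ v.injective,
    Set.ncard_coe_finset]

/-- An early vertex has few preceding neighbors, so only the at most `δ d / 4 + 1` late vertices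
are critical. The preceding neighborhood of a critical late vertex has at least `k` vertices, few
of them late, so that it keeps a quadratic number of non-edges even after the removal of the late
vertices and of the few vertices that the random colors can cover without already having saved
enough. -/
theorem Parameters.colorable {ε δ β η γ d : ℝ} (h : Parameters ε δ β η γ d) (hδ0 : 0 < δ)
    (hδ1 : δ < 1) (hε1 : ε < 1) {V : Type*} (G : SimpleGraph V) {n : ℕ} (v : Fin n ≃ V)
    (hdeg : IsDegeneracyOrder G d v)
    (hearly : ∀ i : Fin n, ((i : ℕ) : ℝ) + 1 ≤ (n : ℝ) - δ * d / 4 →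
      ((forwardNbhd G v i).ncard : ℝ) ≤ (1 - ε) * d)
    (hsparse : ∀ i : Fin n, (edgesIn G (forwardNbhd G v i) : ℝ) ≤ (1 - δ) * (d * (d - 1) / 2)) :
    G.Colorable ⌊(1 - γ) * d⌋₊ := by
  obtain ⟨hβ, hβ1, hβe, hη, hηε, hηδ, hγe, hεd, hδd, -⟩ := id h
  have hd64 : 64 ≤ d := by nlinarith
  have hd0 : 0 < d := by linarith
  have hγ0 : 0 < γ := by rw [hγe]; positivity
  have hγη : γ ≤ η / 4 := by rw [hγe]; nlinarith
  have hηd : η * d ≤ ε * d / 16 := by nlinarith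
  have hηd' : η * d ≤ δ * d / 16 := by nlinarith
  have hγd : γ * d ≤ η * d / 4 := by nlinarith
  have hγd0 : 0 < γ * d := by positivity
  have hεd1 : ε * d ≤ d := by nlinarith
  have hδd1 : δ * d ≤ d := by nlinarith
  set H := G.comap v with hH
  set N := precedingNbrs H with hN
  -- `t` random colors are to save `s` colors at each critical vertex; `q` bounds all degrees.
  set q := ⌊d⌋₊ with hq
  set t := ⌊η * d⌋₊ with ht
  set s := ⌈γ * d⌉₊ + 1 with hs
  set k := ⌊(1 - γ) * d⌋₊ with hk
  have hqd : (q : ℝ) ≤ d := Nat.floor_le hd0.le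
  have htd : (t : ℝ) ≤ η * d := Nat.floor_le (by positivity)
  have htd' : η * d < t + 1 := Nat.lt_floor_add_one _
  have hsd : (s : ℝ) ≤ γ * d + 2 := by
    have := Nat.ceil_lt_add_one hγd0.le
    rw [hs]; push_cast; linarith
  have hsd' : γ * d + 1 ≤ s := by
    have := Nat.le_ceil (γ * d)
    rw [hs]; push_cast; linarith
  have hkd : d - γ * d < k + 1 := by
    have := Nat.lt_floor_add_one ((1 - γ) * d)
    linarith
  have hq2 : 2 ≤ q := Nat.le_floor (by norm_num; linarith)
  have hNd : ∀ i, ((N i).card : ℝ) ≤ d := fun i => by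
    rw [hN, hH, ← ncard_forwardNbhd]; exact hdeg i
  have hNq : ∀ i, (N i).card ≤ q := fun i => Nat.le_floor (hNd i)
  set F : Finset (Fin n) := univ.filter fun i => ((i : ℕ) : ℝ) + 1 ≤ (n : ℝ) - δ * d / 4 with hF
  set L : Finset (Fin n) :=
    univ.filter fun i => ¬ ((i : ℕ) : ℝ) + 1 ≤ (n : ℝ) - δ * d / 4 with hL
  have hLcard : (L.card : ℝ) ≤ δ * d / 4 + 1 := card_filter_lt_add_one_le (by positivity)
  have hNF : ∀ i, (N i ∩ F).card + (N i \ F).card = (N i).card := fun i =>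
    card_inter_add_card_sdiff _ _
  have hNL : ∀ i, ((N i \ F).card : ℝ) ≤ δ * d / 4 + 1 := fun i => by
    refine le_trans ?_ hLcard
    exact_mod_cast card_le_card fun x hx => by
      have := (mem_sdiff.1 hx).2
      simpa [hF, hL] using this
  -- A late vertex with fewer than `k` preceding neighbors needs no saving.
  set J := L.filter fun j => k ≤ (N j).card with hJ
  have hJd : (J.card : ℝ) ≤ d := by
    have : (J.card : ℝ) ≤ L.card := by exact_mod_cast card_filter_le _ _
    linarith
  obtain ⟨c, hct, hcF, hcH, hcJ⟩ := exists_partial_coloring_cost_le H hq2 (F := F)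
    (fun x _ => hNq x) (J := J) (S := fun j => N j ∩ F) (β := β) (s := s) (t := t)
    (fun j _ => inter_subset_right)
    (fun j _ => (card_le_card inter_subset_left).trans (hNq j)) hβ1
    (by
      intro j hj T hT hTcard
      have hkj : k ≤ (N j).card := (mem_filter.1 hj).2
      rw [← hNF j] at hkj
      have hTN : T ⊆ N j := hT.trans inter_subset_left
      have hTd : (T.card : ℝ) ≤ d := (by exact_mod_cast card_le_card hTN : (T.card : ℝ) ≤ _).trans
        (hNd j)
      have h1 : (k : ℝ) ≤ T.card + s + t + (N j \ F).card := by
        exact_mod_cast (by omega : k ≤ T.card + s + t + (N j \ F).card)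
      -- At most `δ d / 4 + 1` late vertices and `s + t` early ones are missing from `T`.
      have hTlow : (1 - 7 * δ / 16) * d ≤ T.card := by
        have := hNL j
        linarith
      have h5 : (q : ℝ) ^ 2 ≤ d ^ 2 := by gcongr
      rw [hβe]
      refine (mul_le_mul_of_nonneg_left h5 (by positivity)).trans ?_
      refine mul_sq_le_nonEdges G v (X := forwardNbhd G v j) (fun x hx => ?_) hδ0 hδ1 hδd hTd
        hTlow (hsparse j)
      rw [← image_precedingNbrs_comap]
      exact ⟨x, hTN hx, rfl⟩)
    (h.mul_pow_mul_two_pow_lt_one hd0 hJd hsd htd')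
  have hFk : ∀ x ∈ F, (N x).card + t < k := by
    intro x hx
    have h1 := hearly x (mem_filter.1 hx).2
    rw [ncard_forwardNbhd] at h1
    have : (((N x).card + t + 1 : ℕ) : ℝ) < ((k + 1 : ℕ) : ℝ) := by
      push_cast
      linarith
    have : (N x).card + t + 1 < k + 1 := by exact_mod_cast this
    omega
  have hcol : H.Colorable k := by
    refine colorable_of_cost_lt H (F := F) (t := t) (c₀ := c) ?_ hct hcF hcH hFk ?_ ?_
    · intro x hx y hy
      have h1 := (mem_filter.1 hx).2
      have h2 : ((y : ℕ) : ℝ) ≤ (x : ℕ) := by exact_mod_cast (Fin.lt_def.1 hy).le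
      exact mem_filter.2 ⟨mem_univ y, by linarith⟩
    · intro x hx
      change cost c (N x) < k
      by_cases hkx : k ≤ (N x).card
      · have h1 := hcJ x (mem_filter.2 ⟨by simpa [hF, hL] using hx, hkx⟩)
        have h2 := cost_le_cost_add_card_sdiff c (S := N x ∩ F) (T := N x)
        rw [sdiff_inter_self_left] at h2
        have h3 := hNF x
        have h4 := hNd x
        have h5 : cost c (N x) + s ≤ (N x).card := by omega
        have h6 : (cost c (N x) : ℝ) + s ≤ (N x).card := by exact_mod_cast h5
        have h7 : ((cost c (N x) + 1 : ℕ) : ℝ) < ((k + 1 : ℕ) : ℝ) := by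
          push_cast
          linarith
        have : cost c (N x) + 1 < k + 1 := by exact_mod_cast h7
        omega
      · have h1 := cost_le_cost_add_card_sdiff c (S := ∅) (T := N x)
        have h2 : cost c (∅ : Finset (Fin n)) = 0 := by simp [cost]
        rw [sdiff_empty] at h1
        omega
    · have : ((t : ℕ) : ℝ) < ((k + 1 : ℕ) : ℝ) := by
        push_cast
        linarith
      have : t < k + 1 := by exact_mod_cast this
      omega
  exact hcol.of_hom (SimpleGraph.Iso.comap v G).symm.toHom

end

end DegenColoring

theorem mainTheorem7 (ε δ : ℝ) (hε0 : 0 < ε) (hε1 : ε < 1) (hδ0 : 0 < δ) (hδ1 : δ < 1) :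
    ∃ γ : ℝ, 0 < γ ∧ ∃ d₀ : ℝ, ∀ d : ℝ, d₀ ≤ d →
      ∀ (V : Type*) (G : SimpleGraph V) (n : ℕ) (v : Fin n ≃ V),
        DegenColoring.IsDegeneracyOrder G d v →
        (∀ i : Fin n, ((i : ℕ) : ℝ) + 1 ≤ (n : ℝ) - δ * d / 4 →
          ((DegenColoring.forwardNbhd G v i).ncard : ℝ) ≤ (1 - ε) * d) →
        (∀ i : Fin n, (DegenColoring.edgesIn G (DegenColoring.forwardNbhd G v i) : ℝ)
          ≤ (1 - δ) * (d * (d - 1) / 2)) →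
        ∃ k : ℕ, G.chromaticNumber = (k : ℕ∞) ∧ (k : ℝ) ≤ (1 - γ) * d := by
  obtain ⟨β, η, γ, hγ, d₀, hd₀⟩ := DegenColoring.exists_parameters hε0 hδ0 hδ1
  refine ⟨γ, hγ, d₀, fun d hd V G n v h1 h2 h3 => ?_⟩
  have hP := hd₀ d hd
  have hcol := hP.colorable hδ0 hδ1 hε1 G v h1 h2 h3
  obtain ⟨k, hk⟩ := ENat.ne_top_iff_exists.1
    (SimpleGraph.chromaticNumber_ne_top_iff_exists.2 ⟨_, hcol⟩)
  refine ⟨k, hk.symm, ?_⟩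
  have hle := hcol.chromaticNumber_le
  rw [← hk, Nat.cast_le] at hle
  have hd0 : 0 < d := by nlinarith [hP.le_δ_mul]
  have hγ1 : γ ≤ 1 := by
    have h4 := hP.γ_eq
    nlinarith [hP.β_pos, hP.β_le_one, hP.η_pos, hP.η_le_δ]
  exact (Nat.cast_le.2 hle).trans (Nat.floor_le (mul_nonneg (by linarith) hd0.le))
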